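/- All rings are commutative and Noetherian. For a finitely generated projective module $P$ over a ring $A$, the trace of $h\in\operatorname{End}_A P$ is $\operatorname{trace}(h)=\epsilon(\mu_P^{-1}(h))$, where $\mu_P\colon \operatorname{Hom}_A(P,A)\otimes_A P\to \operatorname{End}_A P$ is the isomorphism $f\otimes x\mapsto (y\mapsto f(y)x)$ and $\epsilon(f\otimes x)=f(x)$. Let $R$ be a ring of Krull dimension one, let $M$ be a finitely generated $R$-module, and let $h\in\operatorname{End}_R M$. Assume that one of the following holds. (1) $R$ is Gorenstein, i.e. for every maximal ideal $\mathfrak m$ the local ring $R_{\mathfrak m}$, with residue field $k$ and dimension $d$, is Cohen–Macaulay with $\dim_k\operatorname{Ext}^d_{R_{\mathfrak m}}(k,R_{\mathfrak m})=1$; $M$ is maximal Cohen–Macaulay, i.e. for every maximal ideal $\mathfrak m$ either $M_{\mathfrak m}=0$ or $\operatorname{depth} M_{\mathfrak m}=\dim R_{\mathfrak m}$; and $Q=R[\text{nonzerodivisors}]^{-1}$ is the total quotient ring of $R$. (2) $R=\bigoplus_{i\ge 0}R_i$ is an $\mathbb N$-graded ring such that $R_0$ is a field; $R$ is Gorenstein,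 i.e., with $\mathfrak m=\bigoplus_{i\ge1}R_i$ and $k=R/\mathfrak m$, the ideal $\mathfrak m$ contains a nonzerodivisor and $\dim_k\operatorname{Ext}^1_R(k,R)=1$; $M$ admits a $\mathbb Z$-grading making it a graded $R$-module and is maximal Cohen–Macaulay, i.e. $\mathfrak m$ contains an element that is a nonzerodivisor on $M$ (this includes $M=0$); and $Q=R[\text{homogeneous nonzerodivisors}]^{-1}$. Assume moreover that $M\otimes_R Q$ is a projective $Q$-module. Then $h$ factors through a projective $R$-module if and only if $\operatorname{trace}(gh\otimes_R Q)\in R$ (as a subring of $Q$) for all $g\in\operatorname{End}_R M$. (In case (2), $g$ and $h$ need not respect the grading.) -/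

import Mathlib

open scoped TensorProduct

universe u v

noncomputable section

namespace TraceLemma

/-- For a finitely generated projective module `P` over a commutative ring `A`, the trace of
`h : P → P` is `ε (μ⁻¹ h)`, where `μ : Hom(P, A) ⊗ P ≃ End P`, `f ⊗ x ↦ (y ↦ f y • x)`, is
`dualTensorHom`, and `ε : Hom(P, A) ⊗ P → A`, `f ⊗ x ↦ f x`, is `contractLeft`. -/
def hattoriTrace (A : Type u) (P : Type v) [CommRing A] [AddCommGroup P] [Module A P]
    [Module.Finite A P] [Module.Projective A P] (h : P →ₗ[A] P) : A :=
  contractLeft A P ((dualTensorHomEquiv A P P).symm h)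

/-- An `R`-linear endomorphism is stably zero if it factors through a projective `R`-module. -/
def IsStablyZero (R : Type u) {M : Type v} [CommRing R] [AddCommGroup M] [Module R M]
    (h : M →ₗ[R] M) : Prop :=
  ∃ (P : Type (max u v)) (_ : AddCommGroup P) (_ : Module R P) (_ : Module.Projective R P)
    (a : M →ₗ[R] P) (b : P →ₗ[R] M), h = b ∘ₗ a

/-- The module `N` admits a weakly regular sequence of length `dim A` consisting of elements of
the ideal `I`. If `A` is Noetherian local with maximal ideal `I` and `N` is finitely generated,
this says that `N` is zero or `depth N = dim A`. The same holds, with the depth taken at `I`, if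
`A` is a connected graded ring, `I` is its graded maximal ideal, and `N` is a finitely generated
graded module (weakly regular sequences in `I` on `N ≠ 0` are then regular, by Nakayama). -/
def HasMaximalDepthAt (A : Type u) [CommRing A] (I : Ideal A) (N : Type v) [AddCommGroup N]
    [Module A N] : Prop :=
  ∃ rs : List A, (∀ r ∈ rs, r ∈ I) ∧ RingTheory.Sequence.IsWeaklyRegular N rs ∧
    ((rs.length : ℕ∞) : WithBot ℕ∞) = ringKrullDim A

/-- The Gorenstein condition for a Noetherian ring `A` with distinguished maximal ideal `I`
(the maximal ideal of a local ring, or the graded maximal ideal of a connected graded ring):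
`A` is Cohen–Macaulay and, with `k = A ⧸ I` and `d = dim A`, the `k`-vector space `Ext^d(k, A)` is
one-dimensional, i.e. isomorphic to `k` as an `A`-module. -/
def IsGorensteinAt (A : Type u) [CommRing A] (I : Ideal A) : Prop :=
  HasMaximalDepthAt A I A ∧
  ∃ d : ℕ, ringKrullDim A = ((d : ℕ∞) : WithBot ℕ∞) ∧
    Nonempty (CategoryTheory.Abelian.Ext (ModuleCat.of A (A ⧸ I)) (ModuleCat.of A A) d
      ≃ₗ[A] (A ⧸ I))

/-- A commutative Noetherian ring is Gorenstein if its localizations at the maximal ideals are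
Gorenstein local rings. -/
def IsGorensteinRing (R : Type u) [CommRing R] : Prop :=
  IsNoetherianRing R ∧ ∀ (m : Ideal R) [m.IsMaximal],
    IsGorensteinAt (Localization.AtPrime m)
      (IsLocalRing.maximalIdeal (Localization.AtPrime m))

/-- A finitely generated module over a Noetherian ring is maximal Cohen–Macaulay if for every
maximal ideal `m` its localization `M_m` is zero or has depth equal to `dim R_m`. -/
def IsMaximalCohenMacaulay (R : Type u) [CommRing R] (M : Type v) [AddCommGroup M]
    [Module R M] : Prop :=
  Module.Finite R M ∧ ∀ (m : Ideal R) [m.IsMaximal],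
    HasMaximalDepthAt (Localization.AtPrime m)
      (IsLocalRing.maximalIdeal (Localization.AtPrime m)) (LocalizedModule m.primeCompl M)

/-- The homogeneous nonzerodivisors of a graded ring. -/
def homogeneousNonZeroDivisors {R : Type u} [CommRing R] (𝒜 : ℕ → AddSubgroup R)
    [GradedRing 𝒜] : Submonoid R :=
  SetLike.homogeneousSubmonoid 𝒜 ⊓ nonZeroDivisors R

/-- The subgroups `ℳ j` make `M` a `ℤ`-graded module over the `ℕ`-graded ring `R = ⨁ 𝒜 i`. -/
def IsModuleGrading {R : Type u} [CommRing R] (𝒜 : ℕ → AddSubgroup R) {M : Type v}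
    [AddCommGroup M] [Module R M] (ℳ : ℤ → AddSubgroup M) : Prop :=
  DirectSum.IsInternal ℳ ∧
    ∀ (i : ℕ) (j : ℤ) (r : R) (x : M), r ∈ 𝒜 i → x ∈ ℳ j → r • x ∈ ℳ ((i : ℤ) + j)

/-- With `Q = S⁻¹R`, and `Q ⊗ M` finitely generated projective over `Q`: for every `R`-linear
endomorphism `g` of `M`, the trace of `gh ⊗ Q` lies in (the image in `Q` of) `R`. -/
def TracesIntegral {R : Type u} [CommRing R] (S : Submonoid R) {M : Type v} [AddCommGroup M]
    [Module R M] [Module.Finite R M] [Module.Projective (Localization S) (Localization S ⊗[R] M)]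
    (h : M →ₗ[R] M) : Prop :=
  ∀ g : M →ₗ[R] M,
    hattoriTrace (Localization S) (Localization S ⊗[R] M)
      ((g ∘ₗ h).baseChange (Localization S)) ∈ (algebraMap R (Localization S)).range

end TraceLemma

end

namespace TraceLemma

/-! Let `S` be the multiplicative set being inverted, and let `T` be the image of `M* ⊗ M` in `End
M`. An endomorphism factors through a projective exactly when it lies in `T`, and then the trace of
`gh` is the evaluation of a tensor over `R`; this is the easy direction.

For the converse, projectivity over `Q` gives `a ∈ S` with `a • y = ∑ f i y • x i`, so `a ·
trace(gh) = ∑ f i (g (h (x i)))`, and integrality of traces becomes divisibility by `a`. Each linear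
form on `T` is `φ ⊗ y ↦ φ (u y)` for some `u ∈ End M`. Hence every form takes on `a • h ∈ T` a value
divisible by `a`, and duality should give `a • h ∈ a • T`, that is, `h ∈ T`.

The duality is `exists_eq_smul_of_forall_dual_dvd`, used for `M` (to find `u`) and for `T` (to
conclude). It reduces modulo a power of `a`, where the quotient of `R` is Artinian with cyclic
socles, so that submodules of finite free modules are cut out by linear forms. Cyclicity of the
socles comes from `Ext¹(k, R) ≅ k`: for a nonzerodivisor `a`, `Hom(k, R/a)` embeds in `Ext¹(k, R)`.
-/

/-- The socle of `A` at every maximal ideal is generated by each of its nonzero elements. -/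
def CyclicSocles (A : Type*) [CommRing A] : Prop :=
  ∀ m : Ideal A, m.IsMaximal → ∀ b c : A, (∀ x ∈ m, x * b = 0) → (∀ x ∈ m, x * c = 0) →
    b ≠ 0 → ∃ r, c = r * b

/-! ### Duality over Artinian rings with cyclic socles, by counting lengths. -/

section Length

variable {A : Type*} [CommRing A]

theorem length_le_length_ker_add {V W : Type*} [AddCommGroup V] [Module A V] [AddCommGroup W]
    [Module A W] (g : V →ₗ[A] W) :
    Module.length A V ≤ Module.length A (LinearMap.ker g) + Module.length A W := by
  rw [Module.length_eq_add_of_exact (LinearMap.ker g).subtype g.rangeRestrict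
    (Submodule.subtype_injective _) g.surjective_rangeRestrict
    (by rw [LinearMap.exact_iff, LinearMap.ker_rangeRestrict, Submodule.range_subtype])]
  gcongr
  exact Module.length_le_of_injective (LinearMap.range g).subtype (Submodule.subtype_injective _)

/-- Left exactness of `Hom(-, A)`: a form vanishing on `U` descends to `N ⧸ U`. -/
theorem length_dual_le_add {N : Type*} [AddCommGroup N] [Module A N] (U : Submodule A N) :
    Module.length A (N →ₗ[A] A) ≤
      Module.length A ((N ⧸ U) →ₗ[A] A) + Module.length A (U →ₗ[A] A) := by
  refine (length_le_length_ker_add (LinearMap.lcomp A A U.subtype)).trans ?_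
  gcongr
  refine Module.length_le_of_injective
    (R := A) (M := (N ⧸ U) →ₗ[A] A) (N := LinearMap.ker (LinearMap.lcomp A A U.subtype))
    { toFun := fun φ => U.liftQ φ.1 fun x hx => LinearMap.congr_fun φ.2 ⟨x, hx⟩
      map_add' := fun φ ψ => by ext; rfl
      map_smul' := fun r φ => by ext; rfl } ?_
  intro φ ψ h
  ext x
  exact LinearMap.congr_fun h (U.mkQ x)

/-- A form is determined by its value at a generator `q`, and that value lies in the socle at the
annihilator of `q`. -/
theorem length_dual_le_one (hA : CyclicSocles A) (N : Type*) [AddCommGroup N] [Module A N]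
    [IsSimpleModule A N] : Module.length A (N →ₗ[A] A) ≤ 1 := by
  have : Nontrivial N := IsSimpleModule.nontrivial A N
  obtain ⟨q, hq⟩ := exists_ne (0 : N)
  have hgen := IsSimpleModule.toSpanSingleton_surjective A hq
  have hmax := IsSimpleModule.ker_toSpanSingleton_isMaximal A hq
  have hkill (φ : N →ₗ[A] A) : ∀ x ∈ LinearMap.ker (LinearMap.toSpanSingleton A N q),
      x * φ q = 0 := by
    intro x hx
    have : x • q = 0 := hx
    rw [← smul_eq_mul, ← map_smul, this, map_zero]
  rcases subsingleton_or_nontrivial (N →ₗ[A] A) with hs | hn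
  · simp
  · refine (Module.length_eq_one_iff.mpr (isSimpleModule_iff_toSpanSingleton_surjective.mpr
      ⟨hn, fun φ hφ ψ => ?_⟩)).le
    have hφq : φ q ≠ 0 := fun h => hφ <| by
      ext y
      obtain ⟨s, rfl⟩ := hgen y
      simp [h]
    obtain ⟨r, hr⟩ := hA _ hmax _ _ (hkill φ) (hkill ψ) hφq
    refine ⟨r, ?_⟩
    ext y
    obtain ⟨s, rfl⟩ := hgen y
    simp [hr]

theorem length_dual_le (hA : CyclicSocles A) {N : Type*} [AddCommGroup N] [Module A N]
    (hN : IsFiniteLength A N) : Module.length A (N →ₗ[A] A) ≤ Module.length A N := by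
  induction hN with
  | of_subsingleton => simp
  | @of_simple_quotient M _ _ U _ _ ih =>
    refine (length_dual_le_add U).trans ?_
    rw [Module.length_eq_add_of_exact U.subtype U.mkQ (Submodule.subtype_injective _)
      (Submodule.mkQ_surjective _) (LinearMap.exact_subtype_mkQ U), add_comm]
    have h1 := length_dual_le_one hA (M ⧸ U)
    have h2 : Module.length A (M ⧸ U) = 1 := Module.length_eq_one A _
    rw [h2]
    gcongr

/-- A finite free module has the same length as its dual, so the bounds `length_dual_le` for `U` and
for the quotient leave no room for strict inequality. -/
theorem length_quotient_dual_eq [IsArtinianRing A] (hA : CyclicSocles A) {ι : Type*} [Finite ι]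
    (U : Submodule A (ι → A)) :
    Module.length A (((ι → A) ⧸ U) →ₗ[A] A) = Module.length A ((ι → A) ⧸ U) := by
  have := Fintype.ofFinite ι
  have hfl (N : Type _) [AddCommGroup N] [Module A N] [Module.Finite A N] :
    IsFiniteLength A N := isFiniteLength_iff_isNoetherian_isArtinian.mpr
      ⟨inferInstance, inferInstance⟩
  refine le_antisymm (length_dual_le hA (hfl _)) ?_
  have h1 := length_dual_le_add U
  rw [← (Module.piEquiv ι A A).length_eq,
    Module.length_eq_add_of_exact U.subtype U.mkQ (Submodule.subtype_injective _)
      (Submodule.mkQ_surjective _) (LinearMap.exact_subtype_mkQ U), add_comm] at h1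
  have h2 := h1.trans (add_le_add_right (length_dual_le hA (hfl U)) _)
  exact (ENat.add_le_add_iff_right Module.length_ne_top).mp h2

/-- Over an Artinian ring with cyclic socles every submodule of a finite free module is cut out
by linear forms. -/
theorem exists_dual_apply_ne_zero [IsArtinianRing A] (hA : CyclicSocles A) {ι : Type*} [Finite ι]
    (W : Submodule A (ι → A)) {v : ι → A} (hv : v ∉ W) :
    ∃ φ : (ι → A) →ₗ[A] A, (∀ w ∈ W, φ w = 0) ∧ φ v ≠ 0 := by
  by_contra! H
  set U := W ⊔ Submodule.span A {v} with hU
  have hWU : W ≤ U := le_sup_left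
  have hvU : v ∈ U := Submodule.mem_sup_right (Submodule.mem_span_singleton_self v)
  let p : ((ι → A) ⧸ W) →ₗ[A] ((ι → A) ⧸ U) := Submodule.factor hWU
  have hp : Function.Surjective p := Submodule.factor_surjective hWU
  -- If every form killing `W` also kills `v`, the dual of the quotient by `U` surjects onto the
  -- dual of the quotient by `W`. Equality of lengths then forces `U = W`.
  have hle : Module.length A ((ι → A) ⧸ W) ≤ Module.length A ((ι → A) ⧸ U) := by
    rw [← length_quotient_dual_eq hA W, ← length_quotient_dual_eq hA U]
    refine Module.length_le_of_surjective (LinearMap.lcomp A A p) fun φ => ?_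
    have hker : U ≤ LinearMap.ker (φ ∘ₗ W.mkQ) := by
      refine sup_le (fun w hw => ?_) ?_
      · simp [(Submodule.Quotient.mk_eq_zero W).mpr hw]
      · rw [Submodule.span_singleton_le_iff_mem]
        exact H (φ ∘ₗ W.mkQ) fun w hw => by simp [(Submodule.Quotient.mk_eq_zero W).mpr hw]
    refine ⟨U.liftQ _ hker, ?_⟩
    apply LinearMap.ext
    intro x
    obtain ⟨x, rfl⟩ := W.mkQ_surjective x
    simp [p]
  rw [Module.length_eq_add_of_exact (LinearMap.ker p).subtype p (Submodule.subtype_injective _) hp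
    (LinearMap.exact_subtype_ker_map p)] at hle
  have h0 : Module.length A (LinearMap.ker p) = 0 := by
    have hle' : Module.length A (LinearMap.ker p) + Module.length A ((ι → A) ⧸ U) ≤
      0 + Module.length A ((ι → A) ⧸ U) := by simpa using hle
    simpa using (ENat.add_le_add_iff_right Module.length_ne_top).mp hle'
  rw [Module.length_eq_zero_iff] at h0
  have hmem : W.mkQ v ∈ LinearMap.ker p := by
    simpa [p] using (Submodule.Quotient.mk_eq_zero U).mpr hvU
  have := congrArg Subtype.val (Subsingleton.elim (⟨_, hmem⟩ : LinearMap.ker p) 0)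
  exact hv ((Submodule.Quotient.mk_eq_zero W).mp this)

end Length
end TraceLemma

namespace TraceLemma

/-! ### Lifting the duality to torsion-free modules on which `a` factors through a free module. -/

section Lattice

variable {R : Type*} [CommRing R]

/-- A linear map all of whose values are divisible by an element regular on the target is
divisible by that element. -/
theorem exists_eq_smul_linearMap {N P : Type*} [AddCommGroup N] [Module R N] [AddCommGroup P]
    [Module R P] {c : R} (hc : IsSMulRegular P c) (L : N →ₗ[R] P) (hL : ∀ y, ∃ z, L y = c • z) :
    ∃ l : N →ₗ[R] P, ∀ y, L y = c • l y := by
  choose l hl using hL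
  refine ⟨{ toFun := l, map_add' := fun x y => hc ?_, map_smul' := fun r x => hc ?_ }, hl⟩
  · simp only [smul_add, ← hl, map_add]
  · simp only [RingHom.id_apply]
    rw [smul_comm, ← hl, ← hl, map_smul]

/-- The maps `f` and `x` identify `N` up to `c` with a submodule of a free module. Working modulo `c
* c` leaves enough room to absorb that error, and a separating form over the quotient lifts to a
combination of the `f i`. -/
theorem exists_eq_smul_of_forall_dual_dvd {N : Type*} [AddCommGroup N] [Module R N] {c : R}
    (hcR : IsSMulRegular R c) (hcN : IsSMulRegular N c)
    (hart : IsArtinianRing (R ⧸ Ideal.span {c * c})) (hsoc : CyclicSocles (R ⧸ Ideal.span {c * c}))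
    {ι : Type*} [Fintype ι] (f : ι → N →ₗ[R] R) (x : ι → N) (hfx : ∀ y, ∑ i, f i y • x i = c • y)
    (t : N) (ht : ∀ l : N →ₗ[R] R, c ∣ l t) : ∃ t', t = c • t' := by
  classical
  set π := Ideal.Quotient.mk (Ideal.span {c * c})
  by_contra! hne
  let F : N →ₗ[R] (ι → R ⧸ Ideal.span {c * c}) :=
    LinearMap.pi fun i => c • (Algebra.linearMap R (R ⧸ Ideal.span {c * c}) ∘ₗ f i)
  have hF (y i) : F y i = π (c * f i y) := by
    simp only [F, LinearMap.pi_apply, LinearMap.smul_apply, LinearMap.comp_apply,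
      Algebra.linearMap_apply, Algebra.smul_def, map_mul]
    rfl
  let W : Submodule (R ⧸ Ideal.span {c * c}) (ι → R ⧸ Ideal.span {c * c}) :=
    { LinearMap.range F with
      smul_mem' := by
        intro r w hw
        obtain ⟨r, rfl⟩ := Ideal.Quotient.mk_surjective r
        exact (LinearMap.range F).smul_mem r hw }
  -- Membership would give `f i t = c * f i y + c * c * z i`; summing against `x i` and cancelling
  -- `c` makes `t` a multiple of `c`.
  have hv : (fun i => π (f i t)) ∉ W := by
    rintro ⟨y, hy⟩
    have hz (i) : ∃ z, f i t = c * f i y + c * c * z := by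
      have h1 : π (f i t) = π (c * f i y) := by rw [← hF, hy]
      rw [Ideal.Quotient.eq, Ideal.mem_span_singleton] at h1
      obtain ⟨z, hz⟩ := h1
      exact ⟨z, by rw [← hz]; ring⟩
    choose z hz using hz
    apply hne (y + ∑ i, z i • x i)
    apply hcN
    simp only
    rw [← hfx t, smul_add, smul_add, ← hfx y, Finset.smul_sum, Finset.smul_sum, Finset.smul_sum,
      ← Finset.sum_add_distrib]
    refine Finset.sum_congr rfl fun i _ => ?_
    rw [hz i]
    module
  obtain ⟨φ, hφW, hφ⟩ := exists_dual_apply_ne_zero hsoc W hv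
  have hr (i) : ∃ r, π r = φ (Pi.single i 1) := Ideal.Quotient.mk_surjective _
  choose r hr using hr
  have hφr (w : ι → R) : φ (fun i => π (w i)) = π (∑ i, r i * w i) := by
    rw [LinearMap.pi_apply_eq_sum_univ φ, map_sum]
    refine Finset.sum_congr rfl fun i _ => ?_
    have hsingle : (fun j => if i = j then (1 : R ⧸ Ideal.span {c * c}) else 0) =
        Pi.single i 1 := by
      ext j
      simp [Pi.single_apply, eq_comm]
    rw [map_mul, hr, smul_eq_mul, hsingle, mul_comm (π (w i))]
  -- Since `φ` kills `W`, the form `∑ r i • f i` is `c • l`. As `c ∣ l t`, its value at `t` is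
  -- divisible by `c * c`, contradicting `φ v ≠ 0`.
  obtain ⟨l, hl⟩ := exists_eq_smul_linearMap hcR (∑ i, r i • f i) fun y => by
    have h0 := hφW _ ⟨y, rfl⟩
    have h1 : F y = fun i => π (c * f i y) := funext (hF y)
    change φ (F y) = 0 at h0
    rw [h1, hφr, Ideal.Quotient.eq_zero_iff_mem, Ideal.mem_span_singleton] at h0
    obtain ⟨z, hz⟩ := h0
    refine ⟨z, hcR ?_⟩
    simp only [LinearMap.sum_apply, LinearMap.smul_apply, smul_eq_mul, Finset.mul_sum]
    rw [← mul_assoc, ← hz]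
    exact Finset.sum_congr rfl fun i _ => by ring
  apply hφ
  obtain ⟨z, hz⟩ := ht l
  rw [hφr, Ideal.Quotient.eq_zero_iff_mem, Ideal.mem_span_singleton]
  have := hl t
  simp only [LinearMap.sum_apply, LinearMap.smul_apply, smul_eq_mul, hz] at this
  exact ⟨z, by rw [this]; ring⟩

/-- If `a` factors through a finite free module and the reductions of `R` modulo powers of `a` are
Artinian Gorenstein, then an endomorphism whose traces against all endomorphisms are integral is a
sum of rank one maps. -/
theorem mem_range_dualTensorHom_of_forall_dvd_sum {M : Type*} [AddCommGroup M] [Module R M] {a : R}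
    (haR : IsSMulRegular R a) (haM : IsSMulRegular M a)
    (hart : ∀ n, IsArtinianRing (R ⧸ Ideal.span {a ^ n}))
    (hsoc : ∀ n, CyclicSocles (R ⧸ Ideal.span {a ^ n}))
    {ι : Type*} [Fintype ι] (f : ι → M →ₗ[R] R) (x : ι → M) (hfx : ∀ y, ∑ i, f i y • x i = a • y)
    (h : M →ₗ[R] M) (hh : ∀ g : M →ₗ[R] M, a ∣ ∑ i, f i (g (h (x i)))) :
    h ∈ LinearMap.range (dualTensorHom R M M) := by
  set T := LinearMap.range (dualTensorHom R M M)
  let τ : Module.Dual R M →ₗ[R] M →ₗ[R] T :=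
    TensorProduct.curry (dualTensorHom R M M).rangeRestrict
  have hτ (φ y z) : (τ φ y).1 z = φ z • y := dualTensorHom_apply ..
  have hE : IsSMulRegular T a := fun s t hst => by
    ext y
    apply haM
    exact LinearMap.congr_fun (congrArg Subtype.val hst) y
  have hfa (φ : M →ₗ[R] R) : ∑ i, φ (x i) • f i = a • φ := by
    ext y
    rw [LinearMap.smul_apply, ← map_smul, ← hfx, map_sum]
    simp [mul_comm]
  -- every linear form on `T` is the trace against an endomorphism
  have hdual (l : T →ₗ[R] R) : ∃ u : M →ₗ[R] M, ∀ φ y, φ (u y) = l (τ φ y) := by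
    have key (φ : M →ₗ[R] R) (y : M) :
        φ (∑ i, l (τ (f i) y) • x i) = a • l (τ φ y) := by
      rw [← map_smul, ← LinearMap.smul_apply, ← map_smul, ← hfa]
      simp [mul_comm]
    obtain ⟨u, hu⟩ := exists_eq_smul_linearMap haM
      -- This map is to be `a • u`. By `key` every `φ` takes multiples of `a` on its values, so
      -- duality for `M` allows division by `a`.
      (∑ i, (LinearMap.toSpanSingleton R M (x i)) ∘ₗ l ∘ₗ τ (f i)) fun y => by
        refine exists_eq_smul_of_forall_dual_dvd haR haM (pow_two a ▸ hart 2) (pow_two a ▸ hsoc 2)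
          f x hfx _ fun φ => ?_
        have := key φ y
        exact ⟨l (τ φ y), by simpa using this⟩
    refine ⟨u, fun φ y => haR ?_⟩
    have := hu y
    simp only [LinearMap.sum_apply, LinearMap.comp_apply, LinearMap.toSpanSingleton_apply] at this
    simp only
    rw [← map_smul, ← this, key]
  have h4 : a * a * (a * a) = a ^ 4 := by ring
  -- Multiplication on `T` factors through a free module only after using `f` and `x` on both source
  -- and target of an endomorphism, hence `c = a * a` and the fourth power. The element tested is `a
  -- * a` times `h`, written so that it visibly lies in `T`.
  obtain ⟨t, ht⟩ := exists_eq_smul_of_forall_dual_dvd (N := T) (c := a * a) (haR.mul haR)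
    (hE.mul hE) (h4 ▸ hart 4) (h4 ▸ hsoc 4)
    (fun p : ι × ι => f p.2 ∘ₗ LinearMap.applyₗ (x p.1) ∘ₗ T.subtype)
    (fun p => τ (f p.1) (x p.2)) (by
      intro t
      ext y
      simp only [Submodule.coe_sum, Submodule.coe_smul, LinearMap.sum_apply, LinearMap.smul_apply,
        hτ, Fintype.sum_prod_type, LinearMap.comp_apply, LinearMap.applyₗ_apply_apply,
        Submodule.subtype_apply]
      simp only [smul_comm _ (f _ y), ← Finset.smul_sum, hfx]
      simp only [← map_smul, ← map_sum, smul_comm _ a, mul_smul]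
      rw [← Finset.smul_sum, hfx])
    (a • ∑ i, τ (f i) (h (x i))) (by
      intro l
      obtain ⟨u, hu⟩ := hdual l
      rw [map_smul, map_sum, smul_eq_mul]
      simp only [← hu]
      exact mul_dvd_mul_left a (hh u))
  have : h = t.1 := by
    ext y
    apply haM
    apply haM
    have := LinearMap.congr_fun (congrArg Subtype.val ht) y
    simp only [Submodule.coe_sum, Submodule.coe_smul, LinearMap.sum_apply, LinearMap.smul_apply,
        hτ, mul_smul] at this
    have hah : a • h y = ∑ i, f i y • h (x i) := by
      rw [← map_smul, ← hfx, map_sum]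
      simp only [map_smul]
    simp only
    rw [hah, this]
  exact this ▸ t.2

end Lattice
end TraceLemma

namespace TraceLemma

/-! ### Finite-rank maps, traces after localization, and the criterion for a multiplicative set. -/

section Trace

variable {R : Type u} [CommRing R] {M : Type v} [AddCommGroup M] [Module R M]

theorem hattoriTrace_dualTensorHom {A : Type u} {P : Type v} [CommRing A] [AddCommGroup P]
    [Module A P] [Module.Finite A P] [Module.Projective A P] (t : Module.Dual A P ⊗[A] P) :
    hattoriTrace A P (dualTensorHom A P P t) = contractLeft A P t := by
  rw [hattoriTrace]
  congr 1
  exact (dualTensorHomEquiv A P P).symm_apply_apply t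

theorem hattoriTrace_add {A : Type u} {P : Type v} [CommRing A] [AddCommGroup P]
    [Module A P] [Module.Finite A P] [Module.Projective A P] (φ ψ : P →ₗ[A] P) :
    hattoriTrace A P (φ + ψ) = hattoriTrace A P φ + hattoriTrace A P ψ := by
  simp only [hattoriTrace, map_add]

theorem hattoriTrace_smul {A : Type u} {P : Type v} [CommRing A] [AddCommGroup P]
    [Module A P] [Module.Finite A P] [Module.Projective A P] (r : A) (φ : P →ₗ[A] P) :
    hattoriTrace A P (r • φ) = r * hattoriTrace A P φ := by
  simp only [hattoriTrace, map_smul, smul_eq_mul]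

/-- The trace of the base change of a sum of rank one maps. -/
theorem hattoriTrace_baseChange_dualTensorHom {A : Type u} [CommRing A] [Algebra R A]
    [Module.Finite R M] [Module.Projective A (A ⊗[R] M)] (t : Module.Dual R M ⊗[R] M) :
    hattoriTrace A (A ⊗[R] M) ((dualTensorHom R M M t).baseChange A) =
      algebraMap R A (contractLeft R M t) := by
  induction t with
  | zero => simp [hattoriTrace]
  | add s t hs ht => simp only [map_add, LinearMap.baseChange_add, hattoriTrace_add, hs, ht]
  | tmul f x =>
    have h1 : (dualTensorHom R M M (f ⊗ₜ x)).baseChange A =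
        dualTensorHom A (A ⊗[R] M) (A ⊗[R] M)
          (Module.Dual.baseChange A f ⊗ₜ ((1 : A) ⊗ₜ[R] x)) := by
      ext y
      simp [TensorProduct.smul_tmul']
    rw [h1, hattoriTrace_dualTensorHom]
    simp [Algebra.algebraMap_eq_smul_one]

theorem comp_mem_range_dualTensorHom (g : M →ₗ[R] M) {h : M →ₗ[R] M}
    (hh : h ∈ LinearMap.range (dualTensorHom R M M)) :
    g ∘ₗ h ∈ LinearMap.range (dualTensorHom R M M) := by
  obtain ⟨t, rfl⟩ := hh
  exact ⟨g.lTensor _ t, (LinearMap.congr_fun (dualTensorHom_comp_lTensor g) t)⟩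

/-- `P` need not be finitely generated, but the image of `M` is, so only finitely many coordinates
of a splitting of `P` from a free module occur. -/
theorem IsStablyZero.mem_range_dualTensorHom [Module.Finite R M] {h : M →ₗ[R] M}
    (hh : IsStablyZero R h) : h ∈ LinearMap.range (dualTensorHom R M M) := by
  classical
  obtain ⟨P, _, _, _, a, b, rfl⟩ := hh
  obtain ⟨s, hs⟩ := Module.projective_def'.mp ‹Module.Projective R P›
  obtain ⟨G, hG⟩ := Module.Finite.fg_top (R := R) (M := M)
  let X : Finset P := G.biUnion fun y => (s (a y)).support
  have hX (y : M) : s (a y) ∈ Finsupp.supported R R (X : Set P) := by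
    have : (⊤ : Submodule R M) ≤ (Finsupp.supported R R (X : Set P)).comap (s ∘ₗ a) := by
      rw [← hG, Submodule.span_le]
      intro g hg
      rw [SetLike.mem_coe, Submodule.mem_comap, Finsupp.mem_supported]
      exact_mod_cast Finset.subset_biUnion_of_mem (fun y => (s (a y)).support) hg
    exact this trivial
  refine ⟨∑ p ∈ X, (Finsupp.lapply p ∘ₗ s ∘ₗ a) ⊗ₜ b p, ?_⟩
  ext y
  have h1 : Finsupp.linearCombination R id (s (a y)) = a y := LinearMap.congr_fun hs (a y)
  rw [map_sum, LinearMap.sum_apply, LinearMap.comp_apply]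
  conv_rhs => rw [← h1, Finsupp.linearCombination_apply,
    Finsupp.sum_of_support_subset _ ((Finsupp.mem_supported R _).mp (hX y)) _ (by simp), map_sum]
  simp [dualTensorHom_apply]

theorem isStablyZero_of_mem_range_dualTensorHom {h : M →ₗ[R] M}
    (hh : h ∈ LinearMap.range (dualTensorHom R M M)) : IsStablyZero R h := by
  obtain ⟨t, rfl⟩ := hh
  obtain ⟨S, rfl⟩ := TensorProduct.exists_finset t
  let e : ULift.{v} (S → R) ≃ₗ[R] (S → R) := ULift.moduleEquiv
  refine ⟨ULift.{v} (S → R), inferInstance, inferInstance, Module.Projective.of_equiv e.symm,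
    e.symm.toLinearMap ∘ₗ LinearMap.pi fun p : S => p.1.1,
    (∑ p : S, LinearMap.toSpanSingleton R M p.1.2 ∘ₗ LinearMap.proj p) ∘ₗ e.toLinearMap, ?_⟩
  ext y
  simp only [map_sum, LinearMap.sum_apply, dualTensorHom_apply, LinearMap.comp_apply,
    LinearEquiv.coe_coe, LinearEquiv.apply_symm_apply, LinearMap.proj_apply, LinearMap.pi_apply,
    LinearMap.toSpanSingleton_apply]
  exact (Finset.sum_coe_sort S fun p => p.1 y • p.2).symm

/-- If the localization of a finitely presented `S`-torsion-free module is projective, then some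
element of `S` acts on the module as a sum of rank one maps. -/
theorem exists_sum_smul_eq_smul [Module.FinitePresentation R M] (S : Submonoid R)
    (hS : ∀ s ∈ S, IsSMulRegular M s)
    [Module.Projective (Localization S) (Localization S ⊗[R] M)] :
    ∃ a ∈ S, ∃ (n : ℕ) (f : Fin n → M →ₗ[R] R) (x : Fin n → M),
      ∀ y, ∑ i, f i y • x i = a • y := by
  obtain ⟨n, π, hπ⟩ := Module.Finite.exists_fin' R M
  let Q := Localization S
  let j : M →ₗ[R] Q ⊗[R] M := TensorProduct.mk R Q M 1
  let k : (Fin n → R) →ₗ[R] Q ⊗[R] (Fin n → R) := TensorProduct.mk R Q (Fin n → R) 1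
  have hj : IsLocalizedModule S j := inferInstance
  have hk : IsLocalizedModule S k := inferInstance
  obtain ⟨σ, hσ⟩ := Module.projective_lifting_property (π.baseChange Q) LinearMap.id
    (LinearMap.lTensor_surjective Q hπ)
  -- Clearing denominators in the section `σ` of the localized presentation: `s` becomes `a • σ`
  -- after localization.
  obtain ⟨s, a, hs⟩ := Module.FinitePresentation.exists_lift_of_isLocalizedModule S k
    (σ.restrictScalars R ∘ₗ j)
  refine ⟨a, a.2, n, fun i => LinearMap.proj i ∘ₗ s, fun i => π (Pi.single i 1), fun y => ?_⟩
  have hinj : Function.Injective j := fun y z hyz => by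
    obtain ⟨c, hc⟩ := (IsLocalizedModule.eq_iff_exists S j).mp hyz
    exact hS c c.2 hc
  apply hinj
  have h1 : ∑ i, (LinearMap.proj i ∘ₗ s) y • π (Pi.single i 1) = π (s y) := by
    rw [LinearMap.pi_apply_eq_sum_univ π (s y)]
    refine Finset.sum_congr rfl fun i _ => ?_
    rw [LinearMap.comp_apply, LinearMap.proj_apply]
    congr 2
    ext l
    simp [Pi.single_apply, eq_comm]
  have h2 : j (π (s y)) = π.baseChange Q (k (s y)) := by simp [j, k]
  have h3 : k (s y) = a • σ (j y) := LinearMap.congr_fun hs y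
  have h4 : π.baseChange Q (σ (j y)) = j y := LinearMap.congr_fun hσ (j y)
  rw [h1, h2, h3, Submonoid.smul_def, LinearMap.map_smul_of_tower, h4, map_smul]

theorem isSMulRegular_of_mem_nonZeroDivisors {a : R} (ha : a ∈ nonZeroDivisors R) :
    IsSMulRegular R a := fun _ _ h => (mul_cancel_left_mem_nonZeroDivisors ha).mp h

/-- The trace criterion for a multiplicative set `S` of nonzerodivisors, regular on `M`, such that
`R` is Artinian Gorenstein modulo every element of `S`. -/
theorem isStablyZero_iff_tracesIntegral [IsNoetherianRing R] [Module.Finite R M]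
    (S : Submonoid R) (hSR : S ≤ nonZeroDivisors R) (hSM : ∀ s ∈ S, IsSMulRegular M s)
    (hart : ∀ s ∈ S, IsArtinianRing (R ⧸ Ideal.span {s}))
    (hsoc : ∀ s ∈ S, CyclicSocles (R ⧸ Ideal.span {s}))
    [Module.Projective (Localization S) (Localization S ⊗[R] M)] (h : M →ₗ[R] M) :
    IsStablyZero R h ↔ TracesIntegral S h := by
  constructor
  · intro hh g
    obtain ⟨t, ht⟩ := comp_mem_range_dualTensorHom g hh.mem_range_dualTensorHom
    rw [← ht, hattoriTrace_baseChange_dualTensorHom]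
    exact ⟨_, rfl⟩
  · intro htr
    have : Module.FinitePresentation R M := Module.finitePresentation_of_finite R M
    obtain ⟨a, ha, n, f, x, hfx⟩ := exists_sum_smul_eq_smul (M := M) S hSM
    refine isStablyZero_of_mem_range_dualTensorHom <| mem_range_dualTensorHom_of_forall_dvd_sum
      (isSMulRegular_of_mem_nonZeroDivisors (hSR ha)) (hSM a ha)
      (fun n => hart _ (pow_mem ha n)) (fun n => hsoc _ (pow_mem ha n)) f x hfx h fun g => ?_
    obtain ⟨r, hr⟩ := htr g
    -- Multiplying `g ∘ₗ h` by `a` makes it a sum of rank one maps, whose trace can be read off in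
    -- `R`.
    have h1 : dualTensorHom R M M (∑ i, f i ⊗ₜ g (h (x i))) = a • (g ∘ₗ h) := by
      ext y
      rw [LinearMap.smul_apply, ← map_smul, ← hfx]
      simp [dualTensorHom_apply]
    have h2 := hattoriTrace_baseChange_dualTensorHom (A := Localization S)
      (∑ i, f i ⊗ₜ[R] g (h (x i)))
    rw [h1, LinearMap.baseChange_smul, ← algebraMap_smul (Localization S) a, hattoriTrace_smul,
      ← hr, ← map_mul] at h2
    refine ⟨r, ?_⟩
    have := IsLocalization.injective (Localization S) hSR h2
    simpa using this.symm

end Trace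
end TraceLemma

namespace TraceLemma
open CategoryTheory

/-! ### From `Ext¹` to socles, and consequences of dimension one. -/

section Socle

variable {A : Type u} [CommRing A]

/-- For a nonzerodivisor `a` in the maximal ideal `I`, the socle of `A / a` embeds in
`Ext¹(A / I, A)`. -/
theorem exists_eq_smul_of_ext_equiv {I : Ideal A} (hI : I.IsMaximal) {a : A}
    (ha : a ∈ nonZeroDivisors A) (haI : a ∈ I)
    (e : Abelian.Ext (ModuleCat.of A (A ⧸ I)) (ModuleCat.of A A) 1 ≃ₗ[A] (A ⧸ I))
    (φ ψ : (A ⧸ I) →ₗ[A] (A ⧸ Ideal.span {a})) (hφ : φ ≠ 0) : ∃ r : A, ψ = r • φ := by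
  let S : ShortComplex (ModuleCat.{u} A) :=
    ShortComplex.mk (ModuleCat.ofHom (LinearMap.lsmul A A a))
      (ModuleCat.ofHom (Ideal.span {a}).mkQ) (by
        ext
        simp)
  have hS : S.ShortExact := by
    refine { exact := ?_, mono_f := ?_, epi_g := ?_ }
    · rw [ShortComplex.moduleCat_exact_iff]
      intro x hx
      have hx' : (Ideal.span {a}).mkQ x = 0 := hx
      rw [Submodule.mkQ_apply, Submodule.Quotient.mk_eq_zero, Ideal.mem_span_singleton] at hx'
      obtain ⟨z, rfl⟩ := hx'
      exact ⟨z, rfl⟩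
    · rw [ModuleCat.mono_iff_injective]
      exact isSMulRegular_of_mem_nonZeroDivisors ha
    · rw [ModuleCat.epi_iff_surjective]
      exact Submodule.mkQ_surjective _
  let δ : ((A ⧸ I) →ₗ[A] (A ⧸ Ideal.span {a})) →
      Abelian.Ext (ModuleCat.of A (A ⧸ I)) (ModuleCat.of A A) 1 := fun θ =>
    (Abelian.Ext.mk₀ (ModuleCat.ofHom θ)).comp hS.extClass (zero_add 1)
  -- The kernel of the connecting map comes from `Hom(A/I, A)`, which vanishes because `a ∈ I` kills
  -- the source and is regular on the target.
  have hδ (θ) (hθ : δ θ = 0) : θ = 0 := by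
    obtain ⟨y, hy⟩ := Abelian.Ext.covariant_sequence_exact₃ _ hS _ (zero_add 1) hθ
    obtain ⟨y, rfl⟩ := (Abelian.Ext.mk₀_bijective _ _).2 y
    have hy0 : y = 0 := by
      ext
      have h1 : a • y.hom (1 : A ⧸ I) = 0 := by
        rw [← map_smul, Algebra.smul_def, mul_one, Ideal.Quotient.algebraMap_eq,
          Ideal.Quotient.eq_zero_iff_mem.mpr haI, map_zero]
      exact isSMulRegular_of_mem_nonZeroDivisors ha (by simpa using h1)
    rw [hy0, Abelian.Ext.mk₀_zero, Abelian.Ext.zero_comp] at hy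
    have := (Abelian.Ext.mk₀_bijective _ _).1 (hy.symm.trans (Abelian.Ext.mk₀_zero _ _).symm)
    exact congrArg ModuleCat.Hom.hom this
  have hδsub (r : A) (θ θ') : δ (θ' - r • θ) = δ θ' - r • δ θ := by
    have : ModuleCat.ofHom (θ' - r • θ) = ModuleCat.ofHom θ' - r • ModuleCat.ofHom θ := rfl
    simp only [δ]
    rw [this, sub_eq_add_neg, Abelian.Ext.mk₀_add, Abelian.Ext.mk₀_neg, Abelian.Ext.mk₀_smul,
      Abelian.Ext.add_comp, Abelian.Ext.neg_comp, Abelian.Ext.smul_comp, sub_eq_add_neg]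
  let := Ideal.Quotient.field I
  have hφ' : e (δ φ) ≠ 0 := fun h => hφ (hδ φ (by simpa using h))
  obtain ⟨r, hr⟩ := Ideal.Quotient.mk_surjective (e (δ ψ) / e (δ φ))
  refine ⟨r, sub_eq_zero.mp (hδ _ ?_)⟩
  apply e.injective
  rw [hδsub, map_sub, map_smul, map_zero, Algebra.smul_def, Ideal.Quotient.algebraMap_eq, hr,
    div_mul_cancel₀ _ hφ', sub_self]

theorem exists_dvd_sub_of_ext_equiv {I : Ideal A} (hI : I.IsMaximal) {a : A}
    (ha : a ∈ nonZeroDivisors A) (haI : a ∈ I)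
    (e : Abelian.Ext (ModuleCat.of A (A ⧸ I)) (ModuleCat.of A A) 1 ≃ₗ[A] (A ⧸ I))
    {b c : A} (hb : ∀ x ∈ I, a ∣ x * b) (hc : ∀ x ∈ I, a ∣ x * c) (hab : ¬ a ∣ b) :
    ∃ r, a ∣ c - r * b := by
  let hom (y : A) (hy : ∀ x ∈ I, a ∣ x * y) : (A ⧸ I) →ₗ[A] (A ⧸ Ideal.span {a}) :=
    I.liftQ (LinearMap.toSpanSingleton A _ (Ideal.Quotient.mk (Ideal.span {a}) y))
      fun x hx => by
        rw [LinearMap.mem_ker, LinearMap.toSpanSingleton_apply, Algebra.smul_def,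
          Ideal.Quotient.algebraMap_eq, ← map_mul, Ideal.Quotient.eq_zero_iff_mem,
          Ideal.mem_span_singleton]
        exact hy x hx
  have hom_one (y hy) : hom y hy (1 : A ⧸ I) = Ideal.Quotient.mk (Ideal.span {a}) y := by
    change LinearMap.toSpanSingleton A _ (Ideal.Quotient.mk (Ideal.span {a}) y) 1 = _
    simp
  obtain ⟨r, hr⟩ := exists_eq_smul_of_ext_equiv hI ha haI e (hom b hb) (hom c hc) fun h => by
    have h1 := LinearMap.congr_fun h 1
    rw [hom_one b hb, LinearMap.zero_apply, Ideal.Quotient.eq_zero_iff_mem,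
      Ideal.mem_span_singleton] at h1
    exact hab h1
  refine ⟨r, ?_⟩
  have h1 := LinearMap.congr_fun hr 1
  rw [LinearMap.smul_apply, hom_one b hb, hom_one c hc, Algebra.smul_def,
    Ideal.Quotient.algebraMap_eq,
    ← map_mul, Ideal.Quotient.eq, Ideal.mem_span_singleton] at h1
  exact h1

theorem cyclicSocles_quotient {R : Type*} [CommRing R] {a : R}
    (H : ∀ m : Ideal R, m.IsMaximal → a ∈ m → ∀ b c : R, (∀ x ∈ m, a ∣ x * b) →
      (∀ x ∈ m, a ∣ x * c) → ¬ a ∣ b → ∃ r, a ∣ c - r * b) :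
    CyclicSocles (R ⧸ Ideal.span {a}) := by
  intro m hm b c hb hc hb0
  obtain ⟨b, rfl⟩ := Ideal.Quotient.mk_surjective b
  obtain ⟨c, rfl⟩ := Ideal.Quotient.mk_surjective c
  have hdvd (y : R) (hy : ∀ x ∈ m, x * Ideal.Quotient.mk (Ideal.span {a}) y = 0) :
      ∀ x ∈ m.comap (Ideal.Quotient.mk (Ideal.span {a})), a ∣ x * y := fun x hx => by
    have := hy _ hx
    rwa [← map_mul, Ideal.Quotient.eq_zero_iff_mem, Ideal.mem_span_singleton] at this
  obtain ⟨r, hr⟩ := H (m.comap (Ideal.Quotient.mk (Ideal.span {a})))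
    (Ideal.comap_isMaximal_of_surjective _ Ideal.Quotient.mk_surjective)
    (by
      rw [Ideal.mem_comap, Ideal.Quotient.eq_zero_iff_mem.mpr (Ideal.mem_span_singleton_self a)]
      exact m.zero_mem) b c (hdvd b hb) (hdvd c hc)
    (fun h => hb0 (Ideal.Quotient.eq_zero_iff_mem.mpr (Ideal.mem_span_singleton.mpr h)))
  exact ⟨Ideal.Quotient.mk _ r, by
    rwa [← map_mul, Ideal.Quotient.eq, Ideal.mem_span_singleton]⟩

theorem krullDimLE_zero_quotient_of_mem_nonZeroDivisors (hdim : ringKrullDim A ≤ 1) {a : A}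
    (ha : a ∈ nonZeroDivisors A) : Ring.KrullDimLE 0 (A ⧸ Ideal.span {a}) := by
  rw [Ring.krullDimLE_iff]
  have h := (ringKrullDim_quotient_succ_le_of_nonZeroDivisor ha).trans hdim
  have h1 : ringKrullDim (A ⧸ Ideal.span {a}) + 1 ≤ 0 + 1 := by simpa using h
  simpa using ENat.WithBot.add_le_add_one_right_iff.mp h1

theorem ringKrullDim_eq_one_of_mem_nonZeroDivisors (hdim : ringKrullDim A ≤ 1) {a : A}
    (ha : a ∈ nonZeroDivisors A) {I : Ideal A} (hI : I ≠ ⊤) (haI : a ∈ I) :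
    ringKrullDim A = 1 := by
  refine hdim.antisymm ?_
  have : Nontrivial (A ⧸ Ideal.span {a}) := Ideal.Quotient.nontrivial_iff.mpr fun h =>
    hI (top_le_iff.mp (h ▸ (Ideal.span_singleton_le_iff_mem I).mpr haI))
  calc (1 : WithBot ℕ∞) = 0 + 1 := by simp
    _ ≤ ringKrullDim (A ⧸ Ideal.span {a}) + 1 := by
      gcongr
      exact ringKrullDim_nonneg_of_nontrivial
    _ ≤ _ := ringKrullDim_quotient_succ_le_of_nonZeroDivisor ha

theorem isMaximal_of_mem_nonZeroDivisors (hdim : ringKrullDim A ≤ 1) {a : A}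
    (ha : a ∈ nonZeroDivisors A) {p : Ideal A} (hp : p.IsPrime) (hap : a ∈ p) : p.IsMaximal := by
  have := krullDimLE_zero_quotient_of_mem_nonZeroDivisors hdim ha
  have hle : RingHom.ker (Ideal.Quotient.mk (Ideal.span {a})) ≤ p := by
    rw [Ideal.mk_ker]
    exact (Ideal.span_singleton_le_iff_mem p).mpr hap
  have hq := Ideal.map_isPrime_of_surjective Ideal.Quotient.mk_surjective hle
  have hqm : (p.map (Ideal.Quotient.mk (Ideal.span {a}))).IsMaximal := inferInstance
  have := Ideal.comap_isMaximal_of_surjective (K := p.map (Ideal.Quotient.mk (Ideal.span {a})))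
    _ Ideal.Quotient.mk_surjective
  rwa [Ideal.comap_map_of_surjective _ Ideal.Quotient.mk_surjective, ← RingHom.ker_eq_comap_bot,
    sup_eq_left.mpr hle] at this

/-- In dimension one, a module of depth one at `I` is torsion-free with respect to every element
whose only prime divisor is `I`. -/
theorem HasMaximalDepthAt.isSMulRegular {I : Ideal A} (hdim : ringKrullDim A = 1)
    {N : Type v} [AddCommGroup N] [Module A N] (hN : HasMaximalDepthAt A I N) {a : A}
    (hprime : ∀ p : Ideal A, p.IsPrime → a ∈ p → p = I) : IsSMulRegular N a := by
  obtain ⟨rs, hmem, hreg, hlen⟩ := hN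
  rw [hdim] at hlen
  obtain ⟨r, rfl⟩ : ∃ r, rs = [r] := List.length_eq_one_iff.mp (by exact_mod_cast hlen)
  have hr : IsSMulRegular N r := by
    rw [RingTheory.Sequence.isWeaklyRegular_cons_iff] at hreg
    exact hreg.1
  -- Some power of the regular element `r` is thus a multiple of `a`, and a factor of a regular
  -- element is regular.
  have hrad : r ∈ (Ideal.span {a}).radical := by
    rw [Ideal.radical_eq_sInf, Submodule.mem_sInf]
    rintro p ⟨hap, hp⟩
    rw [hprime p hp ((Ideal.span_singleton_le_iff_mem p).mp hap)]
    exact hmem r (by simp)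
  obtain ⟨n, hn⟩ := hrad
  obtain ⟨z, hz⟩ := Ideal.mem_span_singleton'.mp hn
  refine IsSMulRegular.of_mul (a := z) ?_
  rw [hz]
  exact hr.pow n

end Socle
end TraceLemma

namespace TraceLemma

theorem IsGorensteinAt.exists_dvd_sub {A : Type u} [CommRing A] {I : Ideal A} (hI : I.IsMaximal)
    (hdim : ringKrullDim A = 1) (hG : IsGorensteinAt A I) {a : A} (ha : a ∈ nonZeroDivisors A)
    (haI : a ∈ I) {b c : A} (hb : ∀ x ∈ I, a ∣ x * b) (hc : ∀ x ∈ I, a ∣ x * c) (hab : ¬ a ∣ b) :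
    ∃ r, a ∣ c - r * b := by
  obtain ⟨-, d, hd, ⟨e⟩⟩ := hG
  obtain rfl : d = 1 := by
    rw [hdim] at hd
    exact_mod_cast hd.symm
  exact exists_dvd_sub_of_ext_equiv hI ha haI e hb hc hab

/-! ### Passing divisibility between `R` and its localization at a maximal ideal. -/

section Local

variable {R : Type u} [CommRing R] (m : Ideal R) [m.IsMaximal]

theorem ringKrullDim_localization_atPrime_le :
    ringKrullDim (Localization.AtPrime m) ≤ ringKrullDim R := by
  rw [IsLocalization.AtPrime.ringKrullDim_eq_height m (Localization.AtPrime m)]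
  exact Ideal.height_le_ringKrullDim_of_ne_top Ideal.IsPrime.ne_top'

theorem algebraMap_mem_nonZeroDivisors_localization (S : Submonoid R) {a : R}
    (ha : a ∈ nonZeroDivisors R) :
    algebraMap R (Localization S) a ∈ nonZeroDivisors (Localization S) :=
  IsLocalization.map_nonZeroDivisors_le S _ (Submonoid.mem_map_of_mem _ ha)

theorem exists_sub_one_mem_of_notMem {s : R} (hs : s ∉ m) : ∃ t, t * s - 1 ∈ m := by
  obtain ⟨t, y, hy, hty⟩ := Ideal.IsMaximal.exists_inv ‹m.IsMaximal› hs
  refine ⟨t, ?_⟩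
  rw [← hty]
  simpa using hy

theorem exists_mul_dvd_of_algebraMap_dvd {a b : R}
    (h : algebraMap R (Localization.AtPrime m) a ∣ algebraMap R (Localization.AtPrime m) b) :
    ∃ s ∉ m, a ∣ s * b := by
  obtain ⟨z, hz⟩ := h
  obtain ⟨⟨z, t⟩, rfl⟩ := IsLocalization.mk'_surjective m.primeCompl z
  have h1 : algebraMap R (Localization.AtPrime m) (t * b) =
      algebraMap R (Localization.AtPrime m) (a * z) := by
    rw [map_mul, hz, map_mul, mul_left_comm, IsLocalization.mk'_spec']
  obtain ⟨c, hc⟩ := (IsLocalization.eq_iff_exists m.primeCompl _).mp h1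
  refine ⟨c * t, (c * t).2, c * z, ?_⟩
  rw [mul_assoc, hc]
  ring

/-- The class of `b` modulo `a` is killed by `m`, so elements outside `m` already act on it
invertibly. -/
theorem dvd_of_algebraMap_dvd_of_forall_dvd {a b : R} (hb : ∀ x ∈ m, a ∣ x * b)
    (h : algebraMap R (Localization.AtPrime m) a ∣ algebraMap R (Localization.AtPrime m) b) :
    a ∣ b := by
  obtain ⟨s, hs, hsb⟩ := exists_mul_dvd_of_algebraMap_dvd m h
  obtain ⟨t, ht⟩ := exists_sub_one_mem_of_notMem m hs
  have h1 : b = t * (s * b) - (t * s - 1) * b := by ring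
  rw [h1]
  exact dvd_sub (hsb.mul_left t) (hb _ ht)

theorem algebraMap_dvd_mul_of_forall_dvd {a b : R} (hb : ∀ x ∈ m, a ∣ x * b) :
    ∀ x ∈ IsLocalRing.maximalIdeal (Localization.AtPrime m),
      algebraMap R (Localization.AtPrime m) a ∣ x * algebraMap R (Localization.AtPrime m) b := by
  intro x hx
  obtain ⟨⟨x, t⟩, rfl⟩ := IsLocalization.mk'_surjective m.primeCompl x
  have hxm : x ∈ m := (IsLocalization.AtPrime.mk'_mem_maximal_iff (Localization.AtPrime m) m x t).mp
    hx
  rw [← IsLocalization.mk'_one (M := m.primeCompl) (Localization.AtPrime m) b,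
    ← IsLocalization.mk'_mul, IsLocalization.mk'_eq_mul_mk'_one]
  exact (map_dvd _ (hb x hxm)).mul_right _

end Local

/-! ### The ungraded case. -/

section Ungraded

variable {R : Type u} [CommRing R]

theorem IsGorensteinRing.cyclicSocles_quotient (hG : IsGorensteinRing R)
    (hdim : ringKrullDim R ≤ 1) {a : R} (ha : a ∈ nonZeroDivisors R) :
    CyclicSocles (R ⧸ Ideal.span {a}) := by
  refine TraceLemma.cyclicSocles_quotient fun m hm ham b c hb hc hab => ?_
  have ha' := algebraMap_mem_nonZeroDivisors_localization m.primeCompl ha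
  have ham' : algebraMap R (Localization.AtPrime m) a ∈
      IsLocalRing.maximalIdeal (Localization.AtPrime m) :=
    (IsLocalization.AtPrime.to_map_mem_maximal_iff (Localization.AtPrime m) m a).mpr ham
  have hdim' := ringKrullDim_eq_one_of_mem_nonZeroDivisors
    ((ringKrullDim_localization_atPrime_le m).trans hdim) ha'
    (IsLocalRing.maximalIdeal.isMaximal _).ne_top ham'
  obtain ⟨r, hr⟩ := (hG.2 m).exists_dvd_sub inferInstance hdim' ha' ham'
    (algebraMap_dvd_mul_of_forall_dvd m hb) (algebraMap_dvd_mul_of_forall_dvd m hc)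
    fun h => hab (dvd_of_algebraMap_dvd_of_forall_dvd m hb h)
  -- The multiplier found in the localization is a fraction `r / t`. On the socle only residues
  -- modulo `m` matter, so an inverse `u` of `t` modulo `m` turns it into `u * r`.
  obtain ⟨⟨r, t⟩, rfl⟩ := IsLocalization.mk'_surjective m.primeCompl r
  obtain ⟨u, hu⟩ := exists_sub_one_mem_of_notMem m t.2
  have hr' : algebraMap R (Localization.AtPrime m) a ∣
      algebraMap R (Localization.AtPrime m) (t * c - r * b) := by
    have : algebraMap R (Localization.AtPrime m) (t * c - r * b) =
        algebraMap R (Localization.AtPrime m) t * (algebraMap R (Localization.AtPrime m) c -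
          IsLocalization.mk' (Localization.AtPrime m) r t *
            algebraMap R (Localization.AtPrime m) b) := by
      rw [mul_sub, ← mul_assoc, IsLocalization.mk'_spec', map_sub, map_mul, map_mul]
    rw [this]
    exact hr.mul_left _
  have hsoc : ∀ x ∈ m, a ∣ x * (t * c - r * b) := fun x hx => by
    have h1 : x * (t * c - r * b) = t * (x * c) - r * (x * b) := by ring
    rw [h1]
    exact dvd_sub ((hc x hx).mul_left _) ((hb x hx).mul_left _)
  have h1 := dvd_of_algebraMap_dvd_of_forall_dvd m hsoc hr'
  refine ⟨u * r, ?_⟩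
  have h2 : c - u * r * b = u * (t * c - r * b) - (u * t - 1) * c := by ring
  rw [h2]
  exact dvd_sub (h1.mul_left u) (hc _ hu)

theorem IsMaximalCohenMacaulay.isSMulRegular (hdim : ringKrullDim R ≤ 1) {M : Type v}
    [AddCommGroup M] [Module R M] (hM : IsMaximalCohenMacaulay R M) {a : R}
    (ha : a ∈ nonZeroDivisors R) : IsSMulRegular M a := by
  refine IsSMulRegular.of_right_eq_zero_of_smul fun y hy => ?_
  refine Module.eq_zero_of_localization_maximal (R := R)
    (fun (m : Ideal R) _ => LocalizedModule m.primeCompl M)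
    (fun m _ => LocalizedModule.mkLinearMap m.primeCompl M) y fun m hm => ?_
  have ha' := algebraMap_mem_nonZeroDivisors_localization m.primeCompl ha
  have hreg : IsSMulRegular (LocalizedModule m.primeCompl M)
      (algebraMap R (Localization.AtPrime m) a) := by
    -- If `a ∈ m`, the localization has dimension one and its maximal ideal is the only prime
    -- containing `a`, so depth one applies; otherwise `a` becomes a unit.
    by_cases ham : a ∈ m
    · have ham' : algebraMap R (Localization.AtPrime m) a ∈
          IsLocalRing.maximalIdeal (Localization.AtPrime m) :=
        (IsLocalization.AtPrime.to_map_mem_maximal_iff (Localization.AtPrime m) m a).mpr ham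
      have hle := (ringKrullDim_localization_atPrime_le m).trans hdim
      have hdim' := ringKrullDim_eq_one_of_mem_nonZeroDivisors hle ha'
        (IsLocalRing.maximalIdeal.isMaximal _).ne_top ham'
      exact (hM.2 m).isSMulRegular hdim' fun p hp hap =>
        IsLocalRing.eq_maximalIdeal (isMaximal_of_mem_nonZeroDivisors hle ha' hp hap)
    · exact (IsLocalization.map_units (Localization.AtPrime m)
        (⟨a, ham⟩ : m.primeCompl)).isSMulRegular _
  refine hreg.right_eq_zero_of_smul ?_
  rw [algebraMap_smul, ← map_smul, hy, map_zero]

end Ungraded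

/-! ### The connected graded case. -/

section Graded

variable {R : Type u} [CommRing R] (𝒜 : ℕ → AddSubgroup R) [GradedRing 𝒜]

/-- A nonzero degree-zero component of an element of `J` would be a unit lying in `J`. -/
theorem toIdeal_le_irrelevant (h0 : IsField (𝒜 0)) {J : HomogeneousIdeal 𝒜}
    (hJ : J.toIdeal ≠ ⊤) : J.toIdeal ≤ (HomogeneousIdeal.irrelevant 𝒜).toIdeal := by
  intro x hx
  have hx0 : (DirectSum.decompose 𝒜 x 0 : R) ∈ J.toIdeal := J.isHomogeneous 0 hx
  change (DirectSum.decompose 𝒜 x 0 : R) = 0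
  by_contra hne
  obtain ⟨y, hy⟩ := h0.mul_inv_cancel (a := DirectSum.decompose 𝒜 x 0)
    fun h => hne (by rw [h]; rfl)
  refine hJ ((Ideal.eq_top_iff_one _).mpr ?_)
  have h1 : (DirectSum.decompose 𝒜 x 0 : R) * y = 1 := congrArg Subtype.val hy
  rw [← h1]
  exact J.toIdeal.mul_mem_right _ hx0

theorem irrelevant_ne_top [Nontrivial R] : (HomogeneousIdeal.irrelevant 𝒜).toIdeal ≠ ⊤ := by
  rw [HomogeneousIdeal.toIdeal_irrelevant]
  exact RingHom.ker_ne_top _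

/-- In a connected graded ring of dimension one, the only prime ideal containing a homogeneous
nonzerodivisor is the irrelevant ideal. -/
theorem eq_irrelevant_of_mem (h0 : IsField (𝒜 0)) (hdim : ringKrullDim R = 1) {a : R}
    (ha : a ∈ homogeneousNonZeroDivisors 𝒜) {p : Ideal R} (hp : p.IsPrime) (hap : a ∈ p) :
    p = (HomogeneousIdeal.irrelevant 𝒜).toIdeal := by
  -- The homogeneous core is a prime that still contains `a`, hence is maximal; it lies in both `p`
  -- and the irrelevant ideal, so it equals both.
  have hq : (p.homogeneousCore 𝒜).toIdeal.IsPrime := hp.homogeneousCore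
  have haq : a ∈ (p.homogeneousCore 𝒜).toIdeal :=
    Ideal.mem_homogeneousCore_of_homogeneous_of_mem ha.1 hap
  have hmax := isMaximal_of_mem_nonZeroDivisors hdim.le ha.2 hq haq
  have : Nontrivial R :=
    ⟨0, 1, fun h => hp.ne_top ((Ideal.eq_top_iff_one p).mpr (h ▸ p.zero_mem))⟩
  rw [← hmax.eq_of_le hp.ne_top (Ideal.toIdeal_homogeneousCore_le 𝒜 p)]
  exact hmax.eq_of_le (irrelevant_ne_top 𝒜) (toIdeal_le_irrelevant 𝒜 h0 hq.ne_top)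

end Graded

end TraceLemma

theorem lemma3p2 (R : Type u) [CommRing R] [IsNoetherianRing R] (hdim : ringKrullDim R = 1)
    (M : Type v) [AddCommGroup M] [Module R M] [Module.Finite R M] (h : M →ₗ[R] M) :
    -- the ungraded case, where `Q` is the total quotient ring
    (∀ [Module.Projective (Localization (nonZeroDivisors R))
          (Localization (nonZeroDivisors R) ⊗[R] M)],
      TraceLemma.IsGorensteinRing R → TraceLemma.IsMaximalCohenMacaulay R M →
      (TraceLemma.IsStablyZero R h ↔ TraceLemma.TracesIntegral (nonZeroDivisors R) h)) ∧
    -- the connected graded case, where `Q` inverts the homogeneous nonzerodivisors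
    (∀ (𝒜 : ℕ → AddSubgroup R) [GradedRing 𝒜] (ℳ : ℤ → AddSubgroup M)
      [Module.Projective (Localization (TraceLemma.homogeneousNonZeroDivisors 𝒜))
          (Localization (TraceLemma.homogeneousNonZeroDivisors 𝒜) ⊗[R] M)],
      IsField (𝒜 0) → TraceLemma.IsModuleGrading 𝒜 ℳ →
      TraceLemma.IsGorensteinAt R (HomogeneousIdeal.irrelevant 𝒜).toIdeal →
      TraceLemma.HasMaximalDepthAt R (HomogeneousIdeal.irrelevant 𝒜).toIdeal M →
      (TraceLemma.IsStablyZero R h ↔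
        TraceLemma.TracesIntegral (TraceLemma.homogeneousNonZeroDivisors 𝒜) h)) := by
  have hart {s : R} (hs : s ∈ nonZeroDivisors R) : IsArtinianRing (R ⧸ Ideal.span {s}) :=
    isArtinianRing_iff_krullDimLE_zero.mpr
      (TraceLemma.krullDimLE_zero_quotient_of_mem_nonZeroDivisors hdim.le hs)
  refine ⟨?_, ?_⟩
  · intro _ hG hM
    exact TraceLemma.isStablyZero_iff_tracesIntegral _ le_rfl
      (fun s hs => hM.isSMulRegular hdim.le hs) (fun s hs => hart hs)
      (fun s hs => hG.cyclicSocles_quotient hdim.le hs) h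
  · intro 𝒜 _ ℳ _ h0 _ hG hM
    refine TraceLemma.isStablyZero_iff_tracesIntegral
      (TraceLemma.homogeneousNonZeroDivisors 𝒜) inf_le_right
      (fun s hs => hM.isSMulRegular hdim fun p hp hsp =>
        TraceLemma.eq_irrelevant_of_mem 𝒜 h0 hdim hs hp hsp) (fun s hs => hart hs.2)
      (fun s hs => TraceLemma.cyclicSocles_quotient fun m hm hsm b c hb hc hsb => ?_) h
    -- The irrelevant ideal is the only maximal ideal at which `R ⧸ (s)` can have a socle, so the
    -- Gorenstein condition there suffices without localizing.
    obtain rfl := TraceLemma.eq_irrelevant_of_mem 𝒜 h0 hdim hs hm.isPrime hsm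
    exact hG.exists_dvd_sub hm hdim hs.2 hsm hb hc hsb
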